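/- Let $k$ be a commutative ring and let $A\subseteq B$ be an extension of (associative, unital) $k$-algebras together with a ring homomorphism $\varphi:B\to \mathrm{End}_k(A)$ such that $\varphi(a)=L_a$ (left multiplication by $a$) for all $a\in A$, and such that $\mathrm{Im}\,\varphi$ contains the multiplication algebra $M(A)$, the subalgebra of $\mathrm{End}_k(A)$ generated by all left and right multiplications. (For instance, $B$ is a subalgebra of $\mathrm{End}_k(A)$ containing $M(A)$.) Regard $A$ as a left $B$-module by $b\cdot a=\varphi(b)(a)$. Its $B$-submodules are two-sided ideals, called the $B$-stable ideals. For a left $B$-module $M$ put $M^B=\{m\in M : b\cdot m=(b\cdot 1_A)\,m \text{ for all } b\in B\}$; then $A^B$ is a subring of $A$, and $M^B$ is an $A^B$-module. Call $A$ $B$-semiprime if $K^2=0$ implies $K=0$ for every $B$-stable ideal $K$, and $B$-prime if $A\neq 0$ and $KL=0$ implies $K=0$ or $L=0$ for all $B$-stable ideals $K,L$. Let $E(A)$ be an injective hull of the $B$-module $A$, and let $\widehat A=\sum_{f\in \mathrm{Hom}_B(A,E(A))}\mathrm{Im} f\supseteq A$ be the self-injective hull of $A$. Assume that $A$ is $B$-semiprime.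 Then the following hold. (1) The map $\Psi:\mathrm{End}_B(\widehat A)\to \widehat A^B$, $\Psi(f)=f(1_A)$, is an isomorphism of $A^B$-modules, and the ring structure that it defines on $\widehat A^B$ makes $\widehat A^B$ a commutative, self-injective, von Neumann regular ring containing $A^B$ as a subring. (2) The map $e\mapsto A\cap \mathrm{Im}\,\Psi^{-1}(e)$ is a bijection from the set of (central) idempotents $e$ of $\widehat A^B$ onto the set of closed $B$-stable ideals of $A$, that is, those that have no proper essential extension among the $B$-submodules of $A$. (3) $\widehat A^B$ is a field if and only if $A$ is $B$-prime. (4) For every $n\ge 1$: $\widehat A^B$ is isomorphic to a product of $n$ fields if and only if $A$ has Goldie dimension $n$ as a $B$-module, that is, some direct sum of $n$ uniform $B$-submodules is essential in $A$. (5) Suppose that $A^B$ is large in $A$, i.e. $A^B\cap I\neq 0$ for every nonzero $B$-stable ideal $I$ of $A$. Then $\widehat A^B$, with the inclusion $A^B\subseteq\widehat A^B$, is the maximal ring of quotients $Q_{\max}(A^B)$, and $A$ is a non-singular $A^B$-module, i.e. no nonzero element of $A$ is annihilated by an essential ideal of $A^B$. -/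

import Mathlib

universe u v

/-! ### Module-theoretic notions -/

section ModuleNotions

variable {R : Type*} [Ring R] {M : Type*} [AddCommGroup M] [Module R M]

/-- `N` is an essential submodule of `L` (for `N ≤ L`): it meets every nonzero submodule of `L`. -/
def IsEssentialIn (N L : Submodule R M) : Prop :=
  N ≤ L ∧ ∀ K : Submodule R M, K ≤ L → N ⊓ K = ⊥ → K = ⊥

/-- An (essentially) closed submodule: it has no proper essential extension inside `M`. -/
def IsEssentiallyClosed (N : Submodule R M) : Prop :=
  ∀ L : Submodule R M, IsEssentialIn N L → L = N

/-- A uniform submodule: nonzero, and any two of its nonzero submodules intersect nontrivially. -/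
def IsUniformSubmodule (U : Submodule R M) : Prop :=
  U ≠ ⊥ ∧ ∀ K L : Submodule R M, K ≤ U → L ≤ U → K ⊓ L = ⊥ → K = ⊥ ∨ L = ⊥

variable (R M) in
/-- `M` has Goldie (uniform) dimension `n`: some direct sum of `n` uniform submodules is
essential in `M`. -/
def HasGoldieDimension (n : ℕ) : Prop :=
  ∃ U : Fin n → Submodule R M,
    (∀ j, IsUniformSubmodule (U j)) ∧ iSupIndep U ∧ IsEssentialIn (⨆ j, U j) ⊤

variable (R M) in
/-- `M` is a non-singular `R`-module: only `0` is annihilated by an essential left ideal. -/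
def IsNonsingularModule : Prop :=
  ∀ m : M, IsEssentialIn (Ideal.torsionOf R M m) (⊤ : Ideal R) → m = 0

/-- The linear map `i : M → E` is an injective hull of `M`: `E` is injective, and `i` is an
embedding with essential image. -/
structure IsInjectiveHull {E : Type*} [AddCommGroup E] [Module R E] (i : M →ₗ[R] E) : Prop where
  module_injective : Module.Injective R E
  injective : Function.Injective i
  essential : IsEssentialIn (LinearMap.range i) ⊤

variable (R M) in
/-- The largest `M`-generated submodule of `E`, the sum of the images of all homomorphisms
`M → E`. When `E` is an injective hull of `M` this is the self-injective hull of `M`. -/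
def selfInjectiveHull (E : Type*) [AddCommGroup E] [Module R E] : Submodule R E :=
  ⨆ f : M →ₗ[R] E, LinearMap.range f

/-- The map `i : M → E`, with values in the self-injective hull. -/
def toSelfInjectiveHull {E : Type*} [AddCommGroup E] [Module R E] (i : M →ₗ[R] E) :
    M →ₗ[R] selfInjectiveHull R M E :=
  i.codRestrict _ fun x =>
    Submodule.mem_iSup_of_mem (p := fun f : M →ₗ[R] E => LinearMap.range f) i
      (LinearMap.mem_range_self i x)

end ModuleNotions

/-! ### Ring-theoretic notions -/

/-- A ring is von Neumann regular if every `x` can be written `x = x y x`. -/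
def IsVonNeumannRegularRing (R : Type*) [Ring R] : Prop :=
  ∀ x : R, ∃ y : R, x * y * x = x

/-- `φ : R → S` makes `S` a (general) ring of quotients of `R`: `R` is a subring of `S` which is
dense in `S` as a left `R`-module. -/
def IsRingOfQuotients {R S : Type*} [Ring R] [Ring S] (φ : R →+* S) : Prop :=
  Function.Injective φ ∧
    ∀ x y : S, y ≠ 0 → ∃ r : R, φ r * x ∈ Set.range φ ∧ φ r * y ≠ 0

/-- `φ : R → S` is the maximal ring of quotients `Q_max(R)`: it is a ring of quotients, and every
ring of quotients of `R` maps to it over `R` (such a map is automatically unique and injective).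
Every ring of quotients of `R` is isomorphic over `R` to one in the universe of `R`. -/
def IsMaximalRingOfQuotients {R : Type u} {S : Type*} [Ring R] [Ring S] (φ : R →+* S) : Prop :=
  IsRingOfQuotients φ ∧
    ∀ (T : Type u) [Ring T] (ψ : R →+* T), IsRingOfQuotients ψ →
      ∃ g : T →+* S, g.comp ψ = φ

/-! ### Extensions with additional module structure -/

section Extension

variable {k A B : Type*} [CommRing k] [Ring A] [Algebra k A] [Ring B] [Algebra k B]
  [Module B A] [SMulCommClass B k A]

variable (k A) in
/-- The multiplication algebra `M(A)`: the subalgebra of `End_k(A)` generated by all left and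
right multiplications. -/
def multiplicationAlgebra : Subalgebra k (Module.End k A) :=
  Algebra.adjoin k
    (Set.range (fun a : A => LinearMap.mulLeft k a) ∪
      Set.range (fun a : A => LinearMap.mulRight k a))

/-- An extension `ι : A ⊆ B` of `k`-algebras with additional module structure. The ring
homomorphism `φ : B → End_k(A)` is `Module.toModuleEnd k A`, the one that belongs to the given
(`k`-linear) action of `B` on `A`; it is required that `φ(a) = L_a` for `a ∈ A` and that
`M(A) ⊆ Im φ`. -/
structure IsModuleExtension (ι : A →ₐ[k] B) : Prop where
  injective : Function.Injective ι
  toModuleEnd_apply : ∀ a : A, Module.toModuleEnd k A (ι a) = LinearMap.mulLeft k a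
  multiplicationAlgebra_subset :
    (multiplicationAlgebra k A : Set (Module.End k A)) ⊆
      Set.range (Module.toModuleEnd k A : B →+* Module.End k A)

/-- `M^B`, the `B`-invariants of a left `B`-module `M`: those `m` with `b • m = (b • 1_A) m` for
all `b`. -/
def bInvariants (ι : A →ₐ[k] B) (M : Type*) [AddCommGroup M] [Module B M] : Set M :=
  {m | ∀ b : B, b • m = ι (b • (1 : A)) • m}

theorem IsModuleExtension.smul_eq {ι : A →ₐ[k] B} (h : IsModuleExtension ι) (a x : A) :
    ι a • x = a * x :=
  LinearMap.congr_fun (h.toModuleEnd_apply a) x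

theorem IsModuleExtension.smul_mul {ι : A →ₐ[k] B} (h : IsModuleExtension ι) {r : A}
    (hr : r ∈ bInvariants ι A) (b : B) (a : A) : b • (a * r) = (b • a) * r := by
  have h1 := hr (b * ι a)
  rw [mul_smul, mul_smul, h.smul_eq, h.smul_eq, h.smul_eq, mul_one] at h1
  exact h1

theorem IsModuleExtension.comm {ι : A →ₐ[k] B} (h : IsModuleExtension ι) {r : A}
    (hr : r ∈ bInvariants ι A) (a : A) : r * a = a * r := by
  obtain ⟨b, hb⟩ := h.multiplicationAlgebra_subset
    (Algebra.subset_adjoin (Or.inr ⟨a, rfl⟩) :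
      LinearMap.mulRight k a ∈ multiplicationAlgebra k A)
  have hb' : ∀ x : A, b • x = x * a := fun x => LinearMap.congr_fun hb x
  have h1 := hr b
  rw [hb', hb', one_mul, h.smul_eq] at h1
  exact h1

/-- `A^B` as a subring of `A`. -/
def invariantSubring (ι : A →ₐ[k] B) (h : IsModuleExtension ι) : Subring A where
  carrier := bInvariants ι A
  zero_mem' := fun b => by simp
  one_mem' := fun b => by rw [h.smul_eq, mul_one]
  add_mem' := fun {x y} hx hy b => by rw [smul_add, smul_add, hx b, hy b]
  neg_mem' := fun {x} hx b => by rw [smul_neg, smul_neg, hx b]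
  mul_mem' := fun {x y} hx hy b => by
    rw [h.smul_mul hy, hx b, h.smul_eq, h.smul_eq, mul_assoc]

/-- Multiplication by `r ∈ A^B`, as a `B`-endomorphism of the self-injective hull of `A`. The
`A^B`-module structure of the endomorphism ring is given by composition with it. -/
def scalarEnd (ι : A →ₐ[k] B) (h : IsModuleExtension ι) (E : Type*) [AddCommGroup E] [Module B E]
    (r : invariantSubring ι h) : Module.End B (selfInjectiveHull B A E) where
  toFun x := ι (r : A) • x
  map_add' := smul_add _
  map_smul' b x := by
    obtain ⟨x, hx⟩ := x
    apply Subtype.ext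
    change ι (r : A) • b • x = b • ι (r : A) • x
    unfold selfInjectiveHull at hx
    induction hx using Submodule.iSup_induction' with
    | mem f x hx =>
      obtain ⟨a, rfl⟩ := hx
      rw [← map_smul, ← map_smul, ← map_smul, ← map_smul, h.smul_eq, h.smul_eq, h.comm r.2,
        h.comm r.2, h.smul_mul r.2]
    | zero => simp
    | add x y _ _ hx hy => simp only [smul_add, hx, hy]

variable (ι : A →ₐ[k] B) in
/-- The extended centre `Â^B`, the `B`-invariants of the self-injective hull `Â ⊆ E` of `A`. -/
abbrev ExtendedCentre (E : Type*) [AddCommGroup E] [Module B E] : Type _ :=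
  bInvariants ι (selfInjectiveHull B A E)

end Extension

section PrimeIdeals

variable {A B : Type*} [Ring A] [Ring B] [Module B A]

/-- A `B`-stable ideal `I` (a `B`-submodule of `A`) is `B`-prime if it is proper and, for
`B`-stable ideals `K`, `L`, the inclusion `KL ⊆ I` implies `K ⊆ I` or `L ⊆ I`. -/
def IsBPrime (I : Submodule B A) : Prop :=
  I ≠ ⊤ ∧ ∀ K L : Submodule B A, (∀ x ∈ K, ∀ y ∈ L, x * y ∈ I) → K ≤ I ∨ L ≤ I

/-- A `B`-stable ideal `I` is `B`-semiprime if `K² ⊆ I` implies `K ⊆ I` for `B`-stable `K`. -/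
def IsBSemiprime (I : Submodule B A) : Prop :=
  ∀ K : Submodule B A, (∀ x ∈ K, ∀ y ∈ K, x * y ∈ I) → K ≤ I

end PrimeIdeals

/-! Everything is proved for the endomorphism ring $S$ of the hull $\widehat A$ and carried to
$\widehat A^B$ by evaluation at $1$. Semiprimeness acts as a non-singularity condition: a
homomorphism from $A$ into an essential extension of $A$ that vanishes on an essential stable ideal
is zero (`le_ker_of_essential`). Since $A$ generates $\widehat A$, an endomorphism is determined by
its values on any essential stable ideal (`end_ext`), and identities in $S$ need only be checked
there.

For $t \in S$ the ideal $\{x \in A : t(x) \in A\}$ is essential; calculating with products of its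
elements shows that $S$ is commutative. Quasi-injectivity of $\widehat A$ inverts $t$ on a
complement of its kernel, which gives regularity, and extends projections onto a summand of a direct
sum of stable ideals. These projections are the idempotents behind closed ideals, primeness and
Goldie dimension.

When $A^B$ is large, it is dense in $S$; a commutative self-injective ring of quotients is maximal.
-/

/-! ### Essential submodules and complements. -/

section EssentialSubmodules

variable {R : Type*} [Ring R] {M N : Type*} [AddCommGroup M] [Module R M]
  [AddCommGroup N] [Module R N]

theorem IsEssentialIn.comap {P : Submodule R N} (hP : IsEssentialIn P ⊤) (f : M →ₗ[R] N) :
    IsEssentialIn (P.comap f) ⊤ := by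
  refine ⟨le_top, fun K _ hK => ?_⟩
  have h1 : K.map f = ⊥ := by
    refine hP.2 _ le_top ?_
    rw [eq_bot_iff]
    rintro _ ⟨hx, k, hk, rfl⟩
    have : k ∈ P.comap f ⊓ K := ⟨hx, hk⟩
    rw [hK, Submodule.mem_bot] at this
    simp [this]
  rw [eq_bot_iff, ← hK]
  intro k hk
  refine ⟨?_, hk⟩
  have : f k ∈ K.map f := Submodule.mem_map_of_mem hk
  rw [h1, Submodule.mem_bot] at this
  simp [this]

theorem IsEssentialIn.inf {P Q : Submodule R M} (hP : IsEssentialIn P ⊤)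
    (hQ : IsEssentialIn Q ⊤) : IsEssentialIn (P ⊓ Q) ⊤ :=
  ⟨le_top, fun K _ hK => hQ.2 K le_top (hP.2 _ le_top (by rwa [← inf_assoc]))⟩

theorem isEssentialIn_finset_inf {α : Type*} (s : Finset α) (P : α → Submodule R M)
    (hP : ∀ a, IsEssentialIn (P a) ⊤) : IsEssentialIn (s.inf P) ⊤ := by
  classical
  induction s using Finset.induction_on with
  | empty => exact ⟨le_top, fun K _ hK => by simpa using hK⟩
  | insert a s _ ih => rw [Finset.inf_insert]; exact (hP a).inf ih

theorem IsEssentialIn.mono {P Q : Submodule R M} (hP : IsEssentialIn P ⊤) (h : P ≤ Q) :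
    IsEssentialIn Q ⊤ :=
  ⟨le_top, fun K hK hQ => hP.2 K hK (eq_bot_iff.2 (hQ ▸ inf_le_inf_right K h))⟩

/-- Every submodule has a complement up to essential extension. -/
theorem exists_inf_eq_bot_isEssentialIn_sup (K : Submodule R M) :
    ∃ C : Submodule R M, K ⊓ C = ⊥ ∧ IsEssentialIn (K ⊔ C) ⊤ := by
  obtain ⟨C, hC⟩ := zorn_le₀ {C : Submodule R M | K ⊓ C = ⊥} (by
    intro c hc hchain
    rcases c.eq_empty_or_nonempty with rfl | hne
    · exact ⟨⊥, by simp, by simp⟩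
    refine ⟨sSup c, ?_, fun z hz => le_sSup hz⟩
    rw [Set.mem_ofPred_eq, eq_bot_iff]
    rintro x ⟨hx, hx'⟩
    obtain ⟨D, hD, hxD⟩ := (Submodule.mem_sSup_of_directed hne hchain.directedOn).1 hx'
    rw [← hc hD]
    exact ⟨hx, hxD⟩)
  have hKC : K ⊓ C = ⊥ := hC.1
  refine ⟨C, hKC, le_top, fun D _ hD => ?_⟩
  -- If $D$ misses $K + C$, then $C + D$ still misses $K$, so maximality of $C$ forces $D \le C$.
  have hmem : K ⊓ (C ⊔ D) = ⊥ := by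
    rw [eq_bot_iff]
    rintro x ⟨hxK, hx⟩
    obtain ⟨c, hc, d, hd, rfl⟩ := Submodule.mem_sup.1 hx
    have hd' : d ∈ (K ⊔ C) ⊓ D := by
      refine ⟨?_, hd⟩
      have := Submodule.add_mem_sup hxK (C.neg_mem hc)
      rwa [show c + d + -c = d by abel] at this
    rw [hD, Submodule.mem_bot] at hd'
    subst hd'
    rw [← hKC]
    exact ⟨hxK, by simpa using hc⟩
  have hle : D ≤ C := le_sup_right.trans (hC.2 hmem le_sup_left)
  rw [eq_bot_iff, ← hD]
  exact fun d hd => ⟨Submodule.mem_sup_right (hle hd), hd⟩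

end EssentialSubmodules

/-! ### Commutative von Neumann regular rings. -/

section VonNeumannRegular

variable {S : Type*} [CommRing S]

/-- In a commutative von Neumann regular ring, finitely many elements of an ideal have a common
unit in the ideal. -/
theorem IsVonNeumannRegularRing.exists_mul_eq_self (hS : IsVonNeumannRegularRing S) (J : Ideal S)
    (s : Finset J) : ∃ e ∈ J, ∀ x ∈ s, e * (x : S) = x := by
  classical
  induction s using Finset.induction_on with
  | empty => exact ⟨0, J.zero_mem, by simp⟩
  | insert a s _ ih =>
    obtain ⟨e, he, hes⟩ := ih
    obtain ⟨y, hy⟩ := hS a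
    -- Chosen so that one minus the new unit is $(1-e)(1-ay)$, which kills both the old elements and
    -- $a$.
    refine ⟨e + a * y - e * (a * y),
      J.sub_mem (J.add_mem he (J.mul_mem_right _ a.2)) (J.mul_mem_right _ he), fun x hx => ?_⟩
    rcases Finset.mem_insert.1 hx with rfl | hx
    · linear_combination (1 - e) * hy
    · linear_combination (1 - (a : S) * y) * hes x hx

theorem IsVonNeumannRegularRing.isMaximal_of_isPrime (hS : IsVonNeumannRegularRing S)
    (P : Ideal S) [hP : P.IsPrime] : P.IsMaximal := by
  refine Ideal.Quotient.maximal_of_isField _ ⟨⟨0, 1, zero_ne_one⟩, mul_comm, fun {a} ha => ?_⟩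
  obtain ⟨x, rfl⟩ := Ideal.Quotient.mk_surjective a
  obtain ⟨y, hy⟩ := hS x
  refine ⟨Ideal.Quotient.mk P y, mul_left_cancel₀ ha ?_⟩
  rw [← map_mul, ← map_mul, mul_one]
  congr 1
  linear_combination hy

end VonNeumannRegular

/-! ### Self-injective rings of quotients are maximal. -/

section RingOfQuotients

variable {R : Type u} {S T : Type*} [Ring R]

/-- A set of elements of a ring of quotients that is annihilated by a dense set is zero. -/
theorem IsRingOfQuotients.eq_of_forall_mul_eq [CommRing S] {φ : R →+* S}
    (hφ : IsRingOfQuotients φ) {D : Set R} (hD : ∀ y : R, y ≠ 0 → ∃ s ∈ D, s * y ≠ 0) {t t' : S}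
    (h : ∀ r ∈ D, φ r * t = φ r * t') : t = t' := by
  by_contra hne
  obtain ⟨r, ⟨r', hr'⟩, hr⟩ := hφ.2 (t - t') (t - t') (sub_ne_zero.2 hne)
  have hr0 : r' ≠ 0 := by
    rintro rfl
    exact hr (by rw [← hr', map_zero])
  obtain ⟨s, hs, hsr⟩ := hD r' hr0
  refine hsr (hφ.1 ?_)
  rw [map_mul, hr', map_zero]
  linear_combination φ r * h s hs

/-- An element $q$ of another ring of quotients is encoded by the pairs $(r, r')$ with $rq = r'$.
Self-injectivity of $S$ turns $r \mapsto r'$ into multiplication by some $t \in S$; density makes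
$t$ unique, hence $q \mapsto t$ a ring homomorphism. -/
theorem IsRingOfQuotients.isMaximalRingOfQuotients [CommRing S] {φ : R →+* S}
    (hφ : IsRingOfQuotients φ) (hS : Module.Baer S S) : IsMaximalRingOfQuotients φ := by
  refine ⟨hφ, fun T _ ψ hψ => ?_⟩
  have hcomm : ∀ a b : R, a * b = b * a := fun a b =>
    hφ.1 (by rw [map_mul, map_mul, mul_comm])
  have hdense : ∀ (q : T) (y : R), y ≠ 0 → ∃ s ∈ {s : R | ψ s * q ∈ Set.range ψ}, s * y ≠ 0 := by
    intro q y hy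
    obtain ⟨s, hs, hsy⟩ := hψ.2 q (ψ y) (by rwa [Ne, map_eq_zero_iff ψ hψ.1])
    exact ⟨s, hs, fun h => hsy (by rw [← map_mul, h, map_zero])⟩
  have hex : ∀ q : T, ∃ t : S, ∀ r r' : R, ψ r * q = ψ r' → φ r * t = φ r' := by
    intro q
    let D : Type u := {p : R × R // ψ p.1 * q = ψ p.2}
    let π : (D →₀ S) →ₗ[S] S := Finsupp.linearCombination S fun p : D => φ p.1.1
    let Φ : (D →₀ S) →ₗ[S] S := Finsupp.linearCombination S fun p : D => φ p.1.2
    -- If $\pi c = 0$, this identity shows that $\Phi c$ is annihilated by a dense set, so $\pi c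
    -- \mapsto \Phi c$ is well defined on the ideal generated by the denominators.
    have key : ∀ (p : D) (c : D →₀ S), φ p.1.1 * Φ c = φ p.1.2 * π c := by
      intro p c
      induction c using Finsupp.induction_linear with
      | zero => simp
      | add c c' h h' => rw [map_add, map_add, mul_add, mul_add, h, h']
      | single p' s =>
        have h1 : φ p.1.1 * φ p'.1.2 = φ p.1.2 * φ p'.1.1 := by
          rw [← map_mul, ← map_mul]
          congr 1
          apply hψ.1
          rw [map_mul, ← p'.2, ← mul_assoc, ← map_mul, hcomm, map_mul, mul_assoc, p.2, ← map_mul,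
            hcomm]
        simp only [π, Φ, Finsupp.linearCombination_single, smul_eq_mul]
        linear_combination s * h1
    have hker : LinearMap.ker π ≤ LinearMap.ker Φ := by
      intro c hc
      refine hφ.eq_of_forall_mul_eq (hdense q) fun r hr => ?_
      obtain ⟨r', hr'⟩ := hr
      have := key ⟨(r, r'), hr'.symm⟩ c
      rw [LinearMap.mem_ker.1 hc, mul_zero] at this
      rw [this, mul_zero]
    obtain ⟨g, hg⟩ := hS.extension_property ((LinearMap.ker π).liftQ π le_rfl)
      (LinearMap.ker_eq_bot.1 (Submodule.ker_liftQ_eq_bot _ _ _ le_rfl))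
      ((LinearMap.ker π).liftQ Φ hker)
    refine ⟨g 1, fun r r' h => ?_⟩
    have h2 := LinearMap.congr_fun hg
      ((LinearMap.ker π).mkQ (Finsupp.single (⟨(r, r'), h⟩ : D) 1))
    simp only [LinearMap.comp_apply, Submodule.mkQ_apply, Submodule.liftQ_apply, π, Φ,
      Finsupp.linearCombination_single, one_smul] at h2
    rw [← h2, ← smul_eq_mul, ← map_smul, smul_eq_mul, mul_one]
  choose g hg using hex
  have hg1 : ∀ r : R, g (ψ r) = φ r := fun r => by simpa using hg (ψ r) 1 r (by simp)
  refine ⟨{ toFun := g, map_one' := ?_, map_zero' := ?_, map_add' := ?_, map_mul' := ?_ }, ?_⟩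
  · simpa using hg1 1
  · intro q q'
    refine hφ.eq_of_forall_mul_eq
      (D := {r | ∃ r₁ r₂, ψ r * q = ψ r₁ ∧ ψ r₁ * q' = ψ r₂}) (fun y hy => ?_) ?_
    · obtain ⟨s, ⟨s₁, hs₁⟩, hs⟩ := hdense q y hy
      obtain ⟨s', ⟨s₂, hs₂⟩, hs'⟩ := hdense q' (s * y) hs
      refine ⟨s' * s, ⟨s' * s₁, s₁ * s₂, ?_, ?_⟩, by rwa [mul_assoc]⟩
      · rw [map_mul, mul_assoc, ← hs₁, map_mul]
      · rw [hcomm, map_mul, mul_assoc, ← hs₂, map_mul]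
    · rintro r ⟨r₁, r₂, h₁, h₂⟩
      rw [hg (q * q') r r₂ (by rw [← mul_assoc, h₁, h₂]), ← mul_assoc, hg q r r₁ h₁,
        hg q' r₁ r₂ h₂]
  · simpa using hg1 0
  · intro q q'
    refine hφ.eq_of_forall_mul_eq
      (D := {r | ∃ r₁ r₂, ψ r * q = ψ r₁ ∧ ψ r * q' = ψ r₂}) (fun y hy => ?_) ?_
    · obtain ⟨s, ⟨s₁, hs₁⟩, hs⟩ := hdense q y hy
      obtain ⟨s', ⟨s₂, hs₂⟩, hs'⟩ := hdense q' (s * y) hs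
      refine ⟨s' * s, ⟨s' * s₁, s * s₂, ?_, ?_⟩, by rwa [mul_assoc]⟩
      · rw [map_mul, mul_assoc, ← hs₁, map_mul]
      · rw [hcomm, map_mul, mul_assoc, ← hs₂, map_mul]
    · rintro r ⟨r₁, r₂, h₁, h₂⟩
      rw [hg (q + q') r (r₁ + r₂) (by rw [mul_add, h₁, h₂, map_add]), mul_add, hg q r r₁ h₁,
        hg q' r r₂ h₂, map_add]
  · ext r
    exact hg1 r

end RingOfQuotients

/-! ### Stable ideals and semiprimeness. -/

section ModuleExtension

variable {k A B : Type*} [CommRing k] [Ring A] [Algebra k A] [Ring B] [Algebra k B]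
  [Module B A] [SMulCommClass B k A] {ι : A →ₐ[k] B}
  {M : Type*} [AddCommGroup M] [Module B M]

theorem IsModuleExtension.map_mul_left (hι : IsModuleExtension ι) (f : A →ₗ[B] M) (a x : A) :
    f (a * x) = ι a • f x := by
  rw [← map_smul, hι.smul_eq]

theorem IsModuleExtension.exists_smul_eq_mul (hι : IsModuleExtension ι) (a : A) :
    ∃ b : B, ∀ x : A, b • x = x * a := by
  obtain ⟨b, hb⟩ := hι.multiplicationAlgebra_subset
    (Algebra.subset_adjoin (Or.inr ⟨a, rfl⟩) :
      LinearMap.mulRight k a ∈ multiplicationAlgebra k A)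
  exact ⟨b, fun x => LinearMap.congr_fun hb x⟩

/-- Right multiplication on $A$ is the action of some element of $B$. This stands in for a right
action on $M$, which is only a left module. -/
theorem IsModuleExtension.map_mul_right (hι : IsModuleExtension ι) {f g : A →ₗ[B] M} {x y : A}
    (h : f x = g y) (a : A) : f (x * a) = g (y * a) := by
  obtain ⟨b, hb⟩ := hι.exists_smul_eq_mul a
  rw [← hb, ← hb, map_smul, map_smul, h]

theorem IsModuleExtension.mul_mem_left (hι : IsModuleExtension ι) {K : Submodule B A} (a : A)
    {x : A} (hx : x ∈ K) : a * x ∈ K := by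
  rw [← hι.smul_eq]
  exact K.smul_mem _ hx

theorem IsModuleExtension.mul_mem_right (hι : IsModuleExtension ι) {K : Submodule B A} (a : A)
    {x : A} (hx : x ∈ K) : x * a ∈ K := by
  obtain ⟨b, hb⟩ := hι.exists_smul_eq_mul a
  rw [← hb]
  exact K.smul_mem _ hx

theorem IsBSemiprime.eq_bot (hA : IsBSemiprime (⊥ : Submodule B A)) {K : Submodule B A}
    (hK : ∀ x ∈ K, ∀ y ∈ K, x * y = 0) : K = ⊥ :=
  le_bot_iff.1 (hA K fun x hx y hy => (Submodule.mem_bot B).2 (hK x hx y hy))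

/-- A homomorphism from a semiprime `A` to an essential extension of `A` vanishes on any stable
ideal in which its kernel is essential. -/
theorem IsModuleExtension.le_ker_of_essential (hι : IsModuleExtension ι)
    (hA : IsBSemiprime (⊥ : Submodule B A)) {i : A →ₗ[B] M} (hinj : Function.Injective i)
    (hess : IsEssentialIn (LinearMap.range i) ⊤) (h : A →ₗ[B] M) {L : Submodule B A}
    (hL : ∀ K ≤ L, LinearMap.ker h ⊓ K = ⊥ → K = ⊥) : L ≤ LinearMap.ker h := by
  set W : Submodule B A := (L.map h).comap i with hW
  have hmul : ∀ w ∈ W, ∃ l ∈ L, ∀ a, i (w * a) = h (l * a) := by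
    rintro w ⟨l, hl, hlw⟩
    exact ⟨l, hl, hι.map_mul_right hlw.symm⟩
  -- For $x, y$ in this ideal with $i(x) = h(l)$, one has $i(xy) = h(ly) = l \cdot h(y) = 0$, so it
  -- squares to zero.
  have hker : LinearMap.ker h ⊓ W = ⊥ := by
    refine hA.eq_bot ?_
    rintro x ⟨-, hx⟩ y ⟨hy, -⟩
    obtain ⟨l, -, hl⟩ := hmul x hx
    apply hinj
    rw [hl, hι.map_mul_left, LinearMap.mem_ker.1 hy, smul_zero, map_zero]
  have hWL : W ⊓ L = ⊥ := hL _ inf_le_right (by rw [← inf_assoc, hker, bot_inf_eq])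
  -- With $i(x) = h(l)$ and $l \in L$, the product $ly$ lies in $W \cap L = 0$, so $i(xy) = h(ly) =
  -- 0$.
  have hW0 : W = ⊥ := by
    refine hA.eq_bot fun x hx y hy => ?_
    obtain ⟨l, hl, hlx⟩ := hmul x hx
    have : l * y ∈ W ⊓ L := ⟨hι.mul_mem_left _ hy, hι.mul_mem_right _ hl⟩
    rw [hWL, Submodule.mem_bot] at this
    apply hinj
    rw [hlx, this, map_zero, map_zero]
  have hmap : L.map h = ⊥ := by
    refine hess.2 _ le_top ?_
    rw [eq_bot_iff]
    rintro _ ⟨⟨w, rfl⟩, hw⟩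
    have : w ∈ W := hw
    rw [hW0, Submodule.mem_bot] at this
    simp [this]
  exact fun l hl => (Submodule.mem_bot B).1 (hmap ▸ Submodule.mem_map_of_mem hl)

end ModuleExtension

/-! ### The self-injective hull and its endomorphism ring. -/

section SelfInjectiveHull

/-- The properties that characterize the self-injective hull `i : M → H` of `M`: `M` is essential
in `H`, the module `H` is quasi-injective, and `H` is generated by `M`. -/
structure IsSelfInjectiveHull {R M H : Type*} [Ring R] [AddCommGroup M] [Module R M]
    [AddCommGroup H] [Module R H] (i : M →ₗ[R] H) : Prop where
  injective : Function.Injective i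
  essential : IsEssentialIn (LinearMap.range i) ⊤
  exists_extension : ∀ (N : Submodule R H) (g : N →ₗ[R] H),
    ∃ t : Module.End R H, ∀ x : N, t x = g x
  iSup_range_eq_top : ⨆ f : M →ₗ[R] H, LinearMap.range f = ⊤

theorem toSelfInjectiveHull_isSelfInjectiveHull {R : Type v} {M : Type*} {E : Type max u v}
    [Ring R] [AddCommGroup M] [Module R M] [AddCommGroup E] [Module R E] {i : M →ₗ[R] E}
    (hi : IsInjectiveHull i) : IsSelfInjectiveHull (toSelfInjectiveHull i) := by
  have hE : Module.Baer R E := Module.Baer.of_injective hi.module_injective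
  refine ⟨fun x y h => hi.injective (congrArg Subtype.val h), ?_, fun N g => ?_, ?_⟩
  · have := hi.essential.comap (selfInjectiveHull R M E).subtype
    refine this.mono ?_
    rintro x ⟨m, hm⟩
    exact ⟨m, Subtype.ext hm⟩
  · obtain ⟨t, ht⟩ := hE.extension_property ((selfInjectiveHull R M E).subtype ∘ₗ N.subtype)
      ((Submodule.injective_subtype _).comp (Submodule.injective_subtype _))
      ((selfInjectiveHull R M E).subtype ∘ₗ g)
    -- The hull is fully invariant in $E$: composing a map $M \to E$ with $t$ gives another such
    -- map.
    have hle : selfInjectiveHull R M E ≤ (selfInjectiveHull R M E).comap t :=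
      iSup_le fun f => by
        rintro _ ⟨m, rfl⟩
        exact Submodule.mem_iSup_of_mem (p := fun f : M →ₗ[R] E => LinearMap.range f) (t ∘ₗ f)
          ⟨m, rfl⟩
    exact ⟨t.restrict hle, fun x => Subtype.ext (LinearMap.congr_fun ht x)⟩
  · rw [eq_top_iff]
    rintro ⟨x, hx⟩ -
    have hx' := hx
    unfold selfInjectiveHull at hx'
    induction hx' using Submodule.iSup_induction' with
    | mem f x hf =>
      obtain ⟨m, rfl⟩ := hf
      have hmem : ∀ m, f m ∈ selfInjectiveHull R M E := fun m =>
        Submodule.mem_iSup_of_mem (p := fun f : M →ₗ[R] E => LinearMap.range f) f ⟨m, rfl⟩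
      exact Submodule.mem_iSup_of_mem
        (p := fun f : M →ₗ[R] selfInjectiveHull R M E => LinearMap.range f)
        (f.codRestrict _ hmem) ⟨m, rfl⟩
    | zero => exact Submodule.zero_mem _
    | add x y hx₁ hy₁ ihx ihy => exact Submodule.add_mem _ (ihx hx₁) (ihy hy₁)

namespace IsSelfInjectiveHull

section Module

variable {R M H : Type*} [Ring R] [AddCommGroup M] [Module R M] [AddCommGroup H] [Module R H]
  {i : M →ₗ[R] H}

/-- Quasi-injectivity for a submodule presented as the image of $\pi$, so that a map on a sum can be
prescribed on generators. -/
theorem exists_factor (hi : IsSelfInjectiveHull i) {X : Type*} [AddCommGroup X] [Module R X]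
    (π Φ : X →ₗ[R] H) (h : LinearMap.ker π ≤ LinearMap.ker Φ) :
    ∃ t : Module.End R H, ∀ x, t (π x) = Φ x := by
  obtain ⟨t, ht⟩ := hi.exists_extension (LinearMap.range π)
    ((LinearMap.ker π).liftQ Φ h ∘ₗ π.quotKerEquivRange.symm.toLinearMap)
  refine ⟨t, fun x => ?_⟩
  have := ht ⟨π x, x, rfl⟩
  rw [this]
  have hx : π.quotKerEquivRange.symm ⟨π x, x, rfl⟩ = (LinearMap.ker π).mkQ x := by
    rw [LinearEquiv.symm_apply_eq]
    rfl
  simp [hx]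

/-- The projection onto one of two independent submodules extends to the hull. -/
theorem exists_projection (hi : IsSelfInjectiveHull i) {K L : Submodule R M} (h : K ⊓ L = ⊥) :
    ∃ p : Module.End R H, (∀ x ∈ K, p (i x) = i x) ∧ ∀ y ∈ L, p (i y) = 0 := by
  obtain ⟨p, hp⟩ := hi.exists_factor (i ∘ₗ K.subtype.coprod L.subtype)
    (i ∘ₗ K.subtype ∘ₗ LinearMap.fst R K L) (by
      rintro ⟨⟨x, hx⟩, ⟨y, hy⟩⟩ hxy
      have h0 : x + y = 0 := hi.injective (by simpa using hxy)
      have : x ∈ K ⊓ L := ⟨hx, by rw [eq_neg_of_add_eq_zero_left h0]; exact L.neg_mem hy⟩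
      rw [h, Submodule.mem_bot] at this
      simp [this])
  exact ⟨p, fun x hx => by simpa using hp (⟨x, hx⟩, 0), fun y hy => by simpa using hp (0, ⟨y, hy⟩)⟩

/-- The elements of $M$ that $t$ sends back into $M$; for $M = A$, calculations with $t$ on them can
use the multiplication of $A$. -/
theorem essential_comap (hi : IsSelfInjectiveHull i) (t : Module.End R H) :
    IsEssentialIn ((LinearMap.range i).comap (t ∘ₗ i)) ⊤ :=
  hi.essential.comap _

theorem essential_map (hi : IsSelfInjectiveHull i) {P : Submodule R M}
    (hP : IsEssentialIn P ⊤) : IsEssentialIn (P.map i) ⊤ := by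
  refine ⟨le_top, fun K _ hK => hi.essential.2 K le_top ?_⟩
  have h1 : K.comap i = ⊥ := by
    refine hP.2 _ le_top ?_
    rw [eq_bot_iff]
    rintro x ⟨hx, hxK⟩
    have : i x ∈ P.map i ⊓ K := ⟨Submodule.mem_map_of_mem hx, hxK⟩
    rw [hK, Submodule.mem_bot, map_eq_zero_iff i hi.injective] at this
    exact this
  rw [eq_bot_iff]
  rintro _ ⟨⟨x, rfl⟩, hx⟩
  have : x ∈ K.comap i := hx
  rw [h1, Submodule.mem_bot] at this
  simp [this]

end Module

variable {k A B H : Type*} [CommRing k] [Ring A] [Algebra k A] [Ring B] [Algebra k B]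
  [Module B A] [SMulCommClass B k A] {ι : A →ₐ[k] B}
  [AddCommGroup H] [Module B H] {i : A →ₗ[B] H}

/-- Endomorphisms of the hull that agree on an essential stable ideal are equal. -/
theorem end_ext (hi : IsSelfInjectiveHull i) (hι : IsModuleExtension ι)
    (hA : IsBSemiprime (⊥ : Submodule B A)) {P : Submodule B A} (hP : IsEssentialIn P ⊤)
    {s t : Module.End B H} (h : ∀ x ∈ P, s (i x) = t (i x)) : s = t := by
  have key : ∀ f : A →ₗ[B] H, LinearMap.range f ≤ LinearMap.ker (s - t) := by
    intro f
    have : (⊤ : Submodule B A) ≤ LinearMap.ker ((s - t) ∘ₗ f) := by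
      refine hι.le_ker_of_essential hA hi.injective hi.essential _ ?_
      refine (((hi.essential_map hP).comap f).mono ?_).2
      rintro a ⟨x, hx, hxa⟩
      rw [LinearMap.mem_ker, LinearMap.comp_apply, ← hxa, LinearMap.sub_apply, h x hx, sub_self]
    rintro _ ⟨a, rfl⟩
    exact this (Submodule.mem_top (x := a))
  have htop : (⊤ : Submodule B H) ≤ LinearMap.ker (s - t) :=
    hi.iSup_range_eq_top ▸ iSup_le key
  ext x
  exact sub_eq_zero.1 (htop (Submodule.mem_top (x := x)))

theorem end_ext_of_comp_eq (hi : IsSelfInjectiveHull i) (hι : IsModuleExtension ι)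
    (hA : IsBSemiprime (⊥ : Submodule B A)) {s t : Module.End B H}
    (h : ∀ x, s (i x) = t (i x)) : s = t :=
  hi.end_ext hι hA (P := ⊤) ⟨le_rfl, fun K _ hK => by simpa using hK⟩ fun x _ => h x

/-- Where $s$ and $t$ both map into $A$, $st(xy) = s(x)\,t(y) = ts(xy)$, because $s$ and $t$ respect
left and right multiplication. A stable ideal missing the kernel of $st - ts$ therefore meets this
domain in an ideal of square zero. -/
theorem end_mul_comm (hi : IsSelfInjectiveHull i) (hι : IsModuleExtension ι)
    (hA : IsBSemiprime (⊥ : Submodule B A)) (s t : Module.End B H) : s * t = t * s := by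
  refine hi.end_ext hι hA (P := LinearMap.ker ((s * t - t * s) ∘ₗ i)) ⟨le_top, fun K _ hK => ?_⟩
    fun x hx => ?_
  · refine ((hi.essential_comap s).inf (hi.essential_comap t)).2 K le_top (hA.eq_bot ?_)
    rintro x ⟨⟨⟨sx, hsx⟩, ⟨tx, htx⟩⟩, hx⟩ y ⟨⟨⟨sy, hsy⟩, ⟨ty, hty⟩⟩, hy⟩
    have hxy : x * y ∈ LinearMap.ker ((s * t - t * s) ∘ₗ i) ⊓ K := by
      refine ⟨?_, hι.mul_mem_left _ hy⟩
      have h1 : s (t (i (x * y))) = i (sx * ty) := by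
        have h2 : t (i (x * y)) = i (x * ty) := by
          rw [hι.map_mul_left, map_smul, hι.map_mul_left, hty]
          rfl
        rw [h2]
        exact (hι.map_mul_right (f := i) (g := s ∘ₗ i) hsx ty).symm
      have h3 : t (s (i (x * y))) = i (sx * ty) := by
        have h4 : s (i (x * y)) = i (sx * y) :=
          (hι.map_mul_right (f := i) (g := s ∘ₗ i) hsx y).symm
        rw [h4, hι.map_mul_left, map_smul, hι.map_mul_left, hty]
        rfl
      exact sub_eq_zero.2 (h1.trans h3.symm)
    rw [hK] at hxy
    exact hxy
  · exact sub_eq_zero.1 hx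

/-- On a complement $C$ of its kernel in $A$, $t$ is injective; $s$ extends the inverse $t(C) \to
C$, and $tst = t$ holds on the essential sum. -/
theorem end_isVonNeumannRegularRing (hi : IsSelfInjectiveHull i) (hι : IsModuleExtension ι)
    (hA : IsBSemiprime (⊥ : Submodule B A)) : IsVonNeumannRegularRing (Module.End B H) := by
  intro t
  obtain ⟨C, hC, hCess⟩ := exists_inf_eq_bot_isEssentialIn_sup (LinearMap.ker (t ∘ₗ i))
  obtain ⟨s, hs⟩ := hi.exists_factor (t ∘ₗ i ∘ₗ C.subtype) (i ∘ₗ C.subtype) (by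
    rintro ⟨x, hx⟩ hxt
    have : x ∈ LinearMap.ker (t ∘ₗ i) ⊓ C := ⟨hxt, hx⟩
    rw [hC, Submodule.mem_bot] at this
    simp [this])
  refine ⟨s, hi.end_ext hι hA hCess fun x hx => ?_⟩
  obtain ⟨y, hy, c, hc, rfl⟩ := Submodule.mem_sup.1 hx
  have h1 : t (i y) = 0 := hy
  have h2 : s (t (i c)) = i c := hs ⟨c, hc⟩
  simp [h1, h2]

/-- The endomorphism ring of the hull is commutative. -/
abbrev endCommRing (hi : IsSelfInjectiveHull i) (hι : IsModuleExtension ι)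
    (hA : IsBSemiprime (⊥ : Submodule B A)) : CommRing (Module.End B H) :=
  { (inferInstance : Ring (Module.End B H)) with mul_comm := hi.end_mul_comm hι hA }

/-- The map $g$ on $J$ is multiplication by an endomorphism $t$ extending $\sum x(a_x) \mapsto \sum
g(x)(a_x)$. -/
theorem end_baer (hi : IsSelfInjectiveHull i) (hι : IsModuleExtension ι)
    (hA : IsBSemiprime (⊥ : Submodule B A)) :
    Module.Baer (Module.End B H) (Module.End B H) := by
  let _ := hi.endCommRing hι hA
  intro J g
  let π : (J →₀ A) →ₗ[B] H := Finsupp.lsum ℕ fun x : J => (x : Module.End B H) ∘ₗ i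
  let Φ : (J →₀ A) →ₗ[B] H := Finsupp.lsum ℕ fun x : J => g x ∘ₗ i
  obtain ⟨t, ht⟩ := hi.exists_factor π Φ (by
    intro c hc
    obtain ⟨e, he, hec⟩ := (hi.end_isVonNeumannRegularRing hι hA).exists_mul_eq_self J c.support
    -- A common unit $e \in J$ of the finitely many $x$ involved gives $g(x) = g(ex) = g(e)x$, so
    -- the assignment is well defined.
    have hΦ : Φ c = g ⟨e, he⟩ (π c) := by
      simp only [Φ, π, Finsupp.lsum_apply, Finsupp.sum, map_sum]
      refine Finset.sum_congr rfl fun x hx => ?_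
      have : g x = g ⟨e, he⟩ * (x : Module.End B H) := by
        rw [mul_comm, ← smul_eq_mul, ← map_smul]
        congr 1
        apply Subtype.ext
        change _ = (x : Module.End B H) * e
        rw [mul_comm, hec x hx]
      rw [this]
      rfl
    rw [LinearMap.mem_ker, hΦ, LinearMap.mem_ker.1 hc, map_zero])
  refine ⟨LinearMap.toSpanSingleton _ _ t, fun x hx => hi.end_ext_of_comp_eq hι hA fun a => ?_⟩
  have := ht (Finsupp.single ⟨x, hx⟩ a)
  simp only [Φ, π, Finsupp.lsum_single, LinearMap.comp_apply] at this
  rw [← this, LinearMap.toSpanSingleton_apply, smul_eq_mul, mul_comm]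
  rfl

/-- The trace `A ∩ Im e` of an idempotent consists of the fixed points. -/
theorem mem_comap_range_iff {e : Module.End B H} (he : IsIdempotentElem e) {x : A} :
    x ∈ (LinearMap.range e).comap i ↔ e (i x) = i x :=
  ⟨fun ⟨y, hy⟩ => by rw [← hy, ← Module.End.mul_apply, he], fun h => ⟨_, h⟩⟩

theorem bijOn_isEssentiallyClosed (hi : IsSelfInjectiveHull i) (hι : IsModuleExtension ι)
    (hA : IsBSemiprime (⊥ : Submodule B A)) :
    Set.BijOn (fun e : Module.End B H => (LinearMap.range e).comap i)
      {e | IsIdempotentElem e} {I : Submodule B A | IsEssentiallyClosed I} := by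
  refine ⟨fun e (he : IsIdempotentElem e) L hL => ?_, fun e he e' he' hee' => ?_, fun I hI => ?_⟩
  · refine le_antisymm (fun x hx => (mem_comap_range_iff he).2 ?_) hL.1
    have := hι.le_ker_of_essential hA hi.injective hi.essential ((1 - e) ∘ₗ i) (L := L)
      (fun K hK hK' => hL.2 K hK (eq_bot_iff.2 (hK' ▸ inf_le_inf_right K fun y hy => ?_)))
    · exact (sub_eq_zero.1 (this hx)).symm
    · exact sub_eq_zero.2 ((mem_comap_range_iff he).1 hy).symm
  -- Equal traces give $e'e = e$ and $ee' = e'$; commutativity then identifies $e$ and $e'$.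
  · have key : ∀ f f' : Module.End B H, IsIdempotentElem f → IsIdempotentElem f' →
        (LinearMap.range f).comap i = (LinearMap.range f').comap i → f' * f = f := by
      intro f f' hf hf' h
      refine hi.end_ext hι hA (hi.essential_comap f) ?_
      rintro x ⟨y, hy⟩
      have hy' : i y = f (i x) := hy
      have : y ∈ (LinearMap.range f').comap i := by
        rw [← h]
        exact ⟨i x, hy'.symm⟩
      rw [Module.End.mul_apply, ← hy', (mem_comap_range_iff hf').1 this]
    rw [← key e e' he he' hee', hi.end_mul_comm hι hA, key e' e he' he hee'.symm]
  · obtain ⟨C, hC, hCess⟩ := exists_inf_eq_bot_isEssentialIn_sup I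
    obtain ⟨p, hpI, hpC⟩ := hi.exists_projection hC
    have hp : IsIdempotentElem p := by
      refine hi.end_ext hι hA hCess fun x hx => ?_
      obtain ⟨y, hy, c, hc, rfl⟩ := Submodule.mem_sup.1 hx
      simp [hpI y hy, hpC c hc]
    -- A fixed point of $p$ in $I + C$ lies in $I$, so the trace of $p$ is an essential extension of
    -- the closed ideal $I$.
    refine ⟨p, hp, hI _ ⟨fun x hx => (mem_comap_range_iff hp).2 (hpI x hx), fun K hK hIK => ?_⟩⟩
    refine hCess.2 K le_top (eq_bot_iff.2 ?_)
    rintro x ⟨hx, hxK⟩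
    obtain ⟨y, hy, c, hc, rfl⟩ := Submodule.mem_sup.1 hx
    have h1 := (mem_comap_range_iff hp).1 (hK hxK)
    rw [map_add, map_add, hpI y hy, hpC c hc, add_zero, ← map_add] at h1
    have h2 : y = y + c := hi.injective h1
    rw [← hIK, ← h2]
    exact ⟨hy, by rwa [← h2] at hxK⟩

/-- The endomorphism ring of the hull is a field if and only if `A` is prime. -/
theorem isField_iff_isBPrime (hi : IsSelfInjectiveHull i) (hι : IsModuleExtension ι)
    (hA : IsBSemiprime (⊥ : Submodule B A)) :
    IsField (Module.End B H) ↔ IsBPrime (⊥ : Submodule B A) := by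
  constructor
  · intro hF
    refine ⟨fun hbot => ?_, fun K L hKL => ?_⟩
    · obtain ⟨s, t, hst⟩ := hF.exists_pair_ne
      refine hst (hi.end_ext_of_comp_eq hι hA fun x => ?_)
      have : x ∈ (⊥ : Submodule B A) := hbot ▸ Submodule.mem_top
      rw [(Submodule.mem_bot B).1 this, map_zero, map_zero, map_zero]
    · have hinf : K ⊓ L = ⊥ := hA.eq_bot fun x hx y hy => (Submodule.mem_bot B).1 (hKL x hx.1 y hy.2)
      obtain ⟨p, hpK, hpL⟩ := hi.exists_projection hinf
      by_cases hp : p = 0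
      · left
        intro x hx
        exact hi.injective (by rw [← hpK x hx, hp]; simp)
      · right
        intro y hy
        obtain ⟨q, hq⟩ := hF.mul_inv_cancel hp
        rw [hi.end_mul_comm hι hA] at hq
        apply hi.injective
        have := LinearMap.congr_fun hq (i y)
        rw [Module.End.mul_apply, hpL y hy, map_zero, Module.End.one_apply] at this
        rw [← this, map_zero]
  · rintro ⟨hne, hprime⟩
    refine ⟨⟨1, 0, fun h => hne ?_⟩, hi.end_mul_comm hι hA, fun {t} ht => ?_⟩
    · refine ((eq_top_iff (a := (⊥ : Submodule B A))).2 fun x _ => ?_)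
      exact hi.injective (by simpa using LinearMap.congr_fun h (i x))
    · obtain ⟨s, hs⟩ := hi.end_isVonNeumannRegularRing hι hA t
      refine ⟨s, ?_⟩
      obtain ⟨C, hC, hCess⟩ := exists_inf_eq_bot_isEssentialIn_sup (LinearMap.ker (t ∘ₗ i))
      have hCK : ∀ x ∈ LinearMap.ker (t ∘ₗ i), ∀ y ∈ C, x * y ∈ (⊥ : Submodule B A) :=
        fun x hx y hy => hC ▸ ⟨hι.mul_mem_right _ hx, hι.mul_mem_left _ hy⟩
      -- If $\ker t$ misses $A$, then $tst = t$ forces $st = 1$; if $C = 0$, the kernel of $t$ is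
      -- essential and $t = 0$.
      rcases hprime _ _ hCK with h | h
      · rw [hi.end_mul_comm hι hA]
        refine hi.end_ext hι hA (hi.essential_comap (s * t - 1)) ?_
        rintro x ⟨y, hy⟩
        have hy' : i y = s (t (i x)) - i x := hy
        have h1 : t (s (t (i x))) = t (i x) := LinearMap.congr_fun hs (i x)
        have h2 : y ∈ LinearMap.ker (t ∘ₗ i) := by
          rw [LinearMap.mem_ker, LinearMap.comp_apply, hy', map_sub, h1, sub_self]
        have h3 := h h2
        rw [Submodule.mem_bot] at h3
        rw [h3, map_zero] at hy'
        exact (sub_eq_zero.1 hy'.symm)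
      · rw [le_bot_iff.1 h, sup_bot_eq] at hCess
        exact absurd (hi.end_ext hι hA (t := 0) hCess fun x hx => hx) ht

end IsSelfInjectiveHull

end SelfInjectiveHull

/-! ### Goldie dimension and products of fields. -/

namespace IsSelfInjectiveHull

section Goldie

variable {k A B : Type*} {H : Type u} [CommRing k] [Ring A] [Algebra k A] [Ring B] [Algebra k B]
  [Module B A] [SMulCommClass B k A] {ι : A →ₐ[k] B}
  [AddCommGroup H] [Module B H] {i : A →ₗ[B] H}

theorem eq_zero_or_injective_on_uniform (hi : IsSelfInjectiveHull i) (hι : IsModuleExtension ι)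
    (hA : IsBSemiprime (⊥ : Submodule B A)) {U : Submodule B A} (hU : IsUniformSubmodule U)
    (t : Module.End B H) : (∀ x ∈ U, t (i x) = 0) ∨ ∀ x ∈ U, t (i x) = 0 → x = 0 := by
  by_cases hK : LinearMap.ker (t ∘ₗ i) ⊓ U = ⊥
  · right
    intro x hx htx
    have : x ∈ LinearMap.ker (t ∘ₗ i) ⊓ U := ⟨htx, hx⟩
    rwa [hK, Submodule.mem_bot] at this
  · left
    intro x hx
    refine hι.le_ker_of_essential hA hi.injective hi.essential (t ∘ₗ i) (fun K hKU hKt => ?_) hx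
    exact (hU.2 _ K inf_le_right hKU (by rw [inf_assoc, inf_eq_right.2 hKU, hKt])).resolve_left hK

/-- The annihilators of the uniform summands are prime, hence maximal by regularity; projections
separate them, and their intersection vanishes on an essential ideal. The Chinese remainder theorem
finishes. -/
theorem exists_ringEquiv_pi_field (hi : IsSelfInjectiveHull i) (hι : IsModuleExtension ι)
    (hA : IsBSemiprime (⊥ : Submodule B A)) {n : ℕ} (h : HasGoldieDimension B A n) :
    ∃ (F : Fin n → Type u) (_ : ∀ l, Field (F l)), Nonempty (Module.End B H ≃+* ∀ l, F l) := by
  classical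
  let _ := hi.endCommRing hι hA
  obtain ⟨U, hU, hind, hess⟩ := h
  let P : Fin n → Ideal (Module.End B H) := fun l =>
    { carrier := {t | ∀ x ∈ U l, t (i x) = 0}
      zero_mem' := fun x _ => rfl
      add_mem' := fun {s t} hs ht x hx => by rw [LinearMap.add_apply, hs x hx, ht x hx, add_zero]
      smul_mem' := fun s t ht x hx => by
        rw [smul_eq_mul, Module.End.mul_apply, ht x hx, map_zero] }
  have hP : ∀ l t, t ∈ P l ↔ ∀ x ∈ U l, t (i x) = 0 := fun _ _ => Iff.rfl
  have hprime : ∀ l, (P l).IsPrime := by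
    intro l
    refine ⟨fun htop => (hU l).1 (eq_bot_iff.2 fun x hx => ?_), fun {s t} hst => ?_⟩
    · exact hi.injective (by simpa using (hP l 1).1 (htop ▸ Submodule.mem_top) x hx)
    · rcases hi.eq_zero_or_injective_on_uniform hι hA (hU l) s with hs | hs
      · exact Or.inl hs
      rcases hi.eq_zero_or_injective_on_uniform hι hA (hU l) t with ht | ht
      · exact Or.inr ht
      -- If $s$ and $t$ are injective on $U_l$ while $st$ kills it, then the part of $U_l$ that $t$
      -- maps into $A$ squares to zero.
      refine absurd ((hi.essential_comap t).2 (U l) le_top (hA.eq_bot ?_)) (hU l).1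
      rintro x ⟨⟨z, hz⟩, hx⟩ y ⟨-, hy⟩
      refine ht _ (hι.mul_mem_left _ hy) ?_
      have h1 : i (z * y) = t (i (x * y)) := hι.map_mul_right (f := i) (g := t ∘ₗ i) hz y
      rw [← h1, hs _ (hι.mul_mem_left _ hy), map_zero]
      rw [h1]
      exact (hP l _).1 hst _ (hι.mul_mem_left _ hy)
  have hmax : ∀ l, (P l).IsMaximal := fun l =>
    (hi.end_isVonNeumannRegularRing hι hA).isMaximal_of_isPrime (P l) (hP := hprime l)
  have hcop : Pairwise (Function.onFun IsCoprime P) := by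
    intro l m hlm
    have := hmax l
    have := hmax m
    refine Ideal.isCoprime_of_isMaximal fun hPP => (hU l).1 ?_
    obtain ⟨p, hpl, hpm⟩ := hi.exists_projection (hind.pairwiseDisjoint hlm).eq_bot
    have : p ∈ P l := by
      rw [hPP]
      exact hpm
    exact eq_bot_iff.2 fun x hx => hi.injective (by rw [← hpl x hx, this x hx, map_zero])
  have hbot : (⨅ l, P l) = ⊥ := by
    refine eq_bot_iff.2 fun t ht => ?_
    refine hi.end_ext hι hA (t := 0) hess fun x hx => ?_
    have hle : (⨆ l, U l) ≤ LinearMap.ker (t ∘ₗ i) :=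
      iSup_le fun l x hx => (Ideal.mem_iInf.1 ht l) x hx
    exact hle hx
  refine ⟨fun l => Module.End B H ⧸ P l, fun l => @Ideal.Quotient.field _ _ (P l) (hmax l), ⟨?_⟩⟩
  exact ((RingEquiv.quotientBot _).symm.trans (Ideal.quotEquivOfEq hbot.symm)).trans
    (Ideal.quotientInfRingEquivPiQuotient P hcop)

/-- The uniform summands are the traces on $A$ of the coordinate idempotents. -/
theorem hasGoldieDimension_of_ringEquiv (hi : IsSelfInjectiveHull i) (hι : IsModuleExtension ι)
    (hA : IsBSemiprime (⊥ : Submodule B A)) {n : ℕ} {F : Fin n → Type*} [∀ l, Field (F l)]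
    (Θ : Module.End B H ≃+* ∀ l, F l) : HasGoldieDimension B A n := by
  classical
  let e : Fin n → Module.End B H := fun l => Θ.symm (Pi.single l 1)
  have he : ∀ l, IsIdempotentElem (e l) := fun l => by
    rw [IsIdempotentElem, ← map_mul, ← Pi.single_mul, one_mul]
  have hemul : ∀ l m, l ≠ m → e l * e m = 0 := fun l m hlm => by
    
    rw [← map_mul, ← map_zero Θ.symm]
    congr 1
    ext p
    by_cases hp : p = l
    · subst hp
      simp [hlm]
    · simp [hp]
  have hesum : ∑ l, e l = 1 := by
    rw [← map_sum, ← map_one Θ.symm]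
    congr 1
    exact Finset.univ_sum_single (1 : ∀ l, F l)
  have hne : ∀ l, e l ≠ 0 := fun l h => by
    have := congrFun ((map_eq_zero_iff Θ.symm Θ.symm.injective).1 h) l
    simp at this
  -- Each corner is a field. Applied to a projection separating two independent submodules of a
  -- trace, this kills one of them.
  have hinv : ∀ l (p : Module.End B H), p * e l = 0 ∨ ∃ q, q * p * e l = e l := fun l p => by
    by_cases h : Θ p l = 0
    · left
      apply Θ.injective
      ext m
      by_cases hm : m = l
      · subst hm
        simp [h]
      · simp [e, hm]
    · right
      refine ⟨Θ.symm (Pi.single l (Θ p l)⁻¹), Θ.injective ?_⟩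
      ext m
      by_cases hm : m = l
      · subst hm
        simp [e, h]
      · simp [e, hm]
  have hmem : ∀ l x, x ∈ (LinearMap.range (e l)).comap i ↔ e l (i x) = i x := fun l x =>
    mem_comap_range_iff (he l)
  refine ⟨fun l => (LinearMap.range (e l)).comap i, fun l => ⟨fun h => hne l ?_, ?_⟩, ?_, ?_⟩
  · refine hi.end_ext hι hA (hi.essential_comap (e l)) ?_
    rintro x ⟨y, hy⟩
    have hy' : i y = e l (i x) := hy
    have : y ∈ (LinearMap.range (e l)).comap i := ⟨i x, hy'.symm⟩
    change (LinearMap.range (e l)).comap i = ⊥ at h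
    rw [h, Submodule.mem_bot] at this
    rw [← hy', this, map_zero, LinearMap.zero_apply]
  · intro K L hK hL hKL
    obtain ⟨p, hpK, hpL⟩ := hi.exists_projection hKL
    rcases hinv l p with h | ⟨q, hq⟩
    · refine Or.inl (eq_bot_iff.2 fun x hx => hi.injective ?_)
      rw [← hpK x hx, ← (hmem l x).1 (hK hx), ← Module.End.mul_apply, h, map_zero]
      rfl
    · refine Or.inr (eq_bot_iff.2 fun x hx => hi.injective ?_)
      rw [← (hmem l x).1 (hL hx), ← hq, Module.End.mul_apply, (hmem l x).1 (hL hx),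
        Module.End.mul_apply, hpL x hx, map_zero, map_zero]
  · intro l
    rw [disjoint_iff, eq_bot_iff]
    rintro x ⟨hx, hx'⟩
    have hle : (⨆ (m) (_ : m ≠ l), (LinearMap.range (e m)).comap i) ≤
        LinearMap.ker (e l ∘ₗ i) :=
      iSup₂_le fun m hm y hy => by
        rw [LinearMap.mem_ker, LinearMap.comp_apply, ← (hmem m y).1 hy, ← Module.End.mul_apply,
          hemul l m hm.symm, LinearMap.zero_apply]
    refine hi.injective ?_
    rw [← (hmem l x).1 hx, map_zero]
    exact hle hx'
  · refine (isEssentialIn_finset_inf Finset.univ _ fun l => hi.essential_comap (e l)).mono ?_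
    intro x hx
    have hx' : ∀ l, ∃ y, i y = e l (i x) := fun l =>
      (Finset.inf_le (f := fun l => (LinearMap.range i).comap (e l ∘ₗ i)) (Finset.mem_univ l) :
        _ ≤ _) hx
    choose y hy using hx'
    have hsum : x = ∑ l, y l := by
      apply hi.injective
      rw [map_sum, Finset.sum_congr rfl fun l _ => hy l, ← LinearMap.sum_apply, hesum]
      rfl
    rw [hsum]
    refine Submodule.sum_mem _ fun l _ => Submodule.mem_iSup_of_mem l ?_
    exact ⟨i x, (hy l).symm⟩

end Goldie

end IsSelfInjectiveHull

/-! ### Invariants, evaluation at $1$, and the case of large $A^B$. -/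

section Invariants

variable {k : Type*} {A : Type u} {B : Type v} [CommRing k] [Ring A] [Algebra k A]
  [Ring B] [Algebra k B] [Module B A] [SMulCommClass B k A] {ι : A →ₐ[k] B}

theorem IsModuleExtension.map_mul_one (hι : IsModuleExtension ι) {M : Type*} [AddCommGroup M]
    [Module B M] (f : A →ₗ[B] M) (a : A) : f a = ι a • f 1 := by
  rw [← hι.map_mul_left, mul_one]

/-- `B`-homomorphisms out of `A` correspond to `B`-invariants. -/
def IsModuleExtension.homOfInvariant (hι : IsModuleExtension ι) {M : Type*} [AddCommGroup M]
    [Module B M] (m : bInvariants ι M) : A →ₗ[B] M where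
  toFun a := ι a • (m : M)
  map_add' a b := by rw [map_add, add_smul]
  map_smul' b a := by
    have := m.2 (b * ι a)
    rw [mul_smul, mul_smul, hι.smul_eq, mul_one] at this
    exact this.symm

variable {E : Type*} [AddCommGroup E] [Module B E] {i : A →ₗ[B] E}

/-- Evaluation at `1`, from the endomorphisms of the hull to the invariants. -/
def evalOne (hι : IsModuleExtension ι) {H : Type*} [AddCommGroup H] [Module B H] (i : A →ₗ[B] H)
    (f : Module.End B H) : bInvariants ι H :=
  ⟨f (i 1), fun b => by
    rw [← map_smul, ← map_smul, ← map_smul, ← map_smul, hι.smul_eq, mul_one]⟩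

theorem evalOne_bijective (hι : IsModuleExtension ι) (hA : IsBSemiprime (⊥ : Submodule B A))
    {H : Type*} [AddCommGroup H] [Module B H] {i : A →ₗ[B] H} (hi : IsSelfInjectiveHull i) :
    Function.Bijective (evalOne hι i) := by
  refine ⟨fun s t hst => hi.end_ext_of_comp_eq hι hA fun x => ?_, fun m => ?_⟩
  · have : s (i 1) = t (i 1) := congrArg Subtype.val hst
    rw [hι.map_mul_one i, map_smul, map_smul, this]
  · obtain ⟨t, ht⟩ := hi.exists_factor i (hι.homOfInvariant m)
      (by rw [LinearMap.ker_eq_bot.2 hi.injective]; exact bot_le)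
    refine ⟨t, Subtype.ext ((ht 1).trans ?_)⟩
    change ι 1 • (m : H) = m
    rw [map_one, one_smul]

theorem scalarEnd_apply (hι : IsModuleExtension ι) (r : invariantSubring ι hι)
    (x : selfInjectiveHull B A E) : scalarEnd ι hι E r x = ι (r : A) • x :=
  rfl

theorem scalarEnd_toSelfInjectiveHull (hι : IsModuleExtension ι) (r : invariantSubring ι hι)
    (i : A →ₗ[B] E) (x : A) : scalarEnd ι hι E r (toSelfInjectiveHull i x) =
      toSelfInjectiveHull i (r * x) := by
  rw [scalarEnd_apply, hι.map_mul_left]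

/-- Multiplication by invariants, as a ring homomorphism. -/
def scalarEndHom (hι : IsModuleExtension ι) (E : Type*) [AddCommGroup E] [Module B E] :
    invariantSubring ι hι →+* Module.End B (selfInjectiveHull B A E) where
  toFun := scalarEnd ι hι E
  map_zero' := LinearMap.ext fun x => by simp [scalarEnd_apply]
  map_one' := LinearMap.ext fun x => by simp [scalarEnd_apply]
  map_add' r s := LinearMap.ext fun x => by simp [scalarEnd_apply, add_smul]
  map_mul' r s := LinearMap.ext fun x => by
    rw [Module.End.mul_apply, scalarEnd_apply, scalarEnd_apply, scalarEnd_apply, ← mul_smul,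
      ← map_mul]
    rfl

theorem scalarEndHom_injective (hι : IsModuleExtension ι)
    (hi : IsSelfInjectiveHull (toSelfInjectiveHull i)) :
    Function.Injective (scalarEndHom hι E) := fun r s h => by
  have := LinearMap.congr_fun h (toSelfInjectiveHull i 1)
  change scalarEnd ι hι E r _ = scalarEnd ι hι E s _ at this
  rw [scalarEnd_toSelfInjectiveHull, scalarEnd_toSelfInjectiveHull, mul_one, mul_one] at this
  exact Subtype.ext (hi.injective this)

/-- Largeness supplies a nonzero invariant $r$ in a complement of $\ker t$ with $s(r) \in A$. Then
$s(r)$ is again invariant, $r$ multiplies $s$ into $A^B$, and $rt \ne 0$ because $t(r) \ne 0$. -/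
theorem scalarEndHom_isRingOfQuotients (hι : IsModuleExtension ι)
    (hA : IsBSemiprime (⊥ : Submodule B A)) (hi : IsSelfInjectiveHull (toSelfInjectiveHull i))
    (hlarge : ∀ I : Submodule B A, I ≠ ⊥ → ∃ r ∈ invariantSubring ι hι, r ∈ I ∧ r ≠ 0) :
    IsRingOfQuotients (scalarEndHom hι E) := by
  refine ⟨scalarEndHom_injective hι hi, fun s t ht => ?_⟩
  obtain ⟨C, hC, hCess⟩ :=
    exists_inf_eq_bot_isEssentialIn_sup (LinearMap.ker (t ∘ₗ toSelfInjectiveHull i))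
  have hC0 : C ≠ ⊥ := by
    rintro rfl
    rw [sup_bot_eq] at hCess
    exact ht (hi.end_ext hι hA (t := 0) hCess fun x hx => hx)
  obtain ⟨r, hr, ⟨⟨a, ha⟩, hrC⟩, hr0⟩ :=
    hlarge _ fun h => hC0 ((hi.essential_comap s).2 C le_top h)
  have ha' : toSelfInjectiveHull i a = s (toSelfInjectiveHull i r) := ha
  have haR : a ∈ bInvariants ι A := fun b => by
    apply hi.injective
    rw [map_smul, map_smul, ha', ← map_smul, ← map_smul, ← map_smul, ← map_smul, hr b]
  have hcomp : ∀ (t : Module.End B (selfInjectiveHull B A E)) (x : A),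
      (scalarEndHom hι E ⟨r, hr⟩ * t) (toSelfInjectiveHull i x) =
        ι x • t (toSelfInjectiveHull i r) := fun t x => by
    change scalarEnd ι hι E ⟨r, hr⟩ (t _) = _
    rw [scalarEnd_apply, ← map_smul, ← map_smul, hι.smul_eq, hι.comm hr, hι.map_mul_left,
      map_smul]
  refine ⟨⟨r, hr⟩, ⟨⟨a, haR⟩, hi.end_ext_of_comp_eq hι hA fun x => ?_⟩, fun h => hr0 ?_⟩
  · rw [hcomp, ← ha', ← hι.map_mul_left, ← hι.comm haR]
    exact scalarEnd_toSelfInjectiveHull hι ⟨a, haR⟩ i x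
  · have h1 : t (toSelfInjectiveHull i r) = 0 := by
      have := hcomp t 1
      rwa [h, map_one ι, one_smul, LinearMap.zero_apply, eq_comm] at this
    have h2 : r ∈ LinearMap.ker (t ∘ₗ toSelfInjectiveHull i) ⊓ C := ⟨h1, hrC⟩
    rwa [hC, Submodule.mem_bot] at h2

/-- The annihilator in $A$ of the ideal $\mathrm{ann}(m)$ is stable and contains $m$; if $m \neq 0$,
it contains a nonzero invariant $r$. Elements of $A^B r \cap \mathrm{ann}(m)$ square to zero, and
$A^B$ is reduced, so $\mathrm{ann}(m)$ is not essential. -/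
theorem isNonsingularModule_of_large (hι : IsModuleExtension ι)
    (hA : IsBSemiprime (⊥ : Submodule B A))
    (hlarge : ∀ I : Submodule B A, I ≠ ⊥ → ∃ r ∈ invariantSubring ι hι, r ∈ I ∧ r ≠ 0) :
    IsNonsingularModule (invariantSubring ι hι) A := by
  have hred : ∀ r ∈ invariantSubring ι hι, r * r = 0 → r = 0 := by
    intro r hr hrr
    let μ : A →ₗ[B] A :=
      { toFun := fun a => a * r
        map_add' := fun a b => add_mul a b r
        map_smul' := fun b a => (hι.smul_mul hr b a).symm }
    have : LinearMap.range μ = ⊥ := by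
      refine hA.eq_bot ?_
      rintro _ ⟨a, rfl⟩ _ ⟨b, rfl⟩
      change a * r * (b * r) = 0
      rw [mul_assoc, ← mul_assoc r, hι.comm hr, mul_assoc b, hrr, mul_zero, mul_zero]
    have h1 : μ 1 ∈ LinearMap.range μ := ⟨1, rfl⟩
    rw [this, Submodule.mem_bot] at h1
    simpa [μ] using h1
  intro m hm
  let N : Submodule B A :=
    { carrier := {a | ∀ r ∈ Ideal.torsionOf (invariantSubring ι hι) A m, a * (r : A) = 0}
      zero_mem' := fun r _ => zero_mul _
      add_mem' := fun ha hb r hr => by rw [add_mul, ha r hr, hb r hr, add_zero]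
      smul_mem' := fun b a ha r hr => by rw [← hι.smul_mul r.2, ha r hr, smul_zero] }
  have hmN : m ∈ N := fun r hr => by rw [← hι.comm r.2]; exact hr
  by_contra hm0
  obtain ⟨r, hr, hrN, hr0⟩ := hlarge N fun h => hm0 (by rwa [h, Submodule.mem_bot] at hmN)
  refine hr0 ?_
  have hspan : Submodule.span (invariantSubring ι hι) {(⟨r, hr⟩ : invariantSubring ι hι)} = ⊥ := by
    refine hm.2 _ le_top ?_
    rw [eq_bot_iff]
    rintro x ⟨hx, hx'⟩
    obtain ⟨s, rfl⟩ := Submodule.mem_span_singleton.1 hx'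
    refine Subtype.ext (hred _ (s • (⟨r, hr⟩ : invariantSubring ι hι)).2 ?_)
    have := hrN _ hx
    change (s : A) * r * (s * r) = 0
    rw [mul_assoc]
    exact (congrArg (fun y => (s : A) * y) this).trans (mul_zero _)
  rw [Submodule.span_singleton_eq_bot] at hspan
  exact congrArg Subtype.val hspan

end Invariants

/-! ### Transport along ring isomorphisms. -/

section Transport

theorem IsMaximalRingOfQuotients.comp_ringEquiv {R : Type u} {S S' : Type*} [Ring R] [Ring S]
    [Ring S'] {φ : R →+* S} (h : IsMaximalRingOfQuotients φ) (Ψ : S ≃+* S') :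
    IsMaximalRingOfQuotients ((Ψ : S →+* S').comp φ) := by
  refine ⟨⟨Ψ.injective.comp h.1.1, fun x y hy => ?_⟩, fun T _ ψ hψ => ?_⟩
  · obtain ⟨r, ⟨r', hr'⟩, hr⟩ := h.1.2 (Ψ.symm x) (Ψ.symm y)
      (by rwa [Ne, map_eq_zero_iff _ Ψ.symm.injective])
    refine ⟨r, ⟨r', ?_⟩, fun h0 => hr (Ψ.injective ?_)⟩
    · simp [hr']
    · simpa using h0
  · obtain ⟨g, hg⟩ := h.2 T ψ hψ
    exact ⟨(Ψ : S →+* S').comp g, by rw [RingHom.comp_assoc, hg]⟩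

theorem IsVonNeumannRegularRing.of_ringEquiv {S S' : Type*} [Ring S] [Ring S']
    (h : IsVonNeumannRegularRing S) (Ψ : S ≃+* S') : IsVonNeumannRegularRing S' := fun x => by
  obtain ⟨y, hy⟩ := h (Ψ.symm x)
  exact ⟨Ψ y, Ψ.symm.injective (by simpa using hy)⟩

theorem Module.Injective.of_ringEquiv_self {S S' : Type*} [Ring S] [Ring S']
    (h : Module.Injective S S) (Ψ : S ≃+* S') : Module.Injective S' S' :=
  Module.Injective.of_ringEquiv Ψ Ψ.toSemilinearEquiv

end Transport

theorem theorem3p1 {k : Type*} {A : Type u} {B : Type v}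
    [CommRing k] [Ring A] [Algebra k A] [Ring B] [Algebra k B]
    [Module B A] [SMulCommClass B k A]
    (ι : A →ₐ[k] B) (hι : IsModuleExtension ι)
    (hA : IsBSemiprime (⊥ : Submodule B A))
    {E : Type (max u v)} [AddCommGroup E] [Module B E]
    (i : A →ₗ[B] E) (hi : IsInjectiveHull i) :
    ∃ (_ : CommRing (ExtendedCentre ι E))
      (Ψ : Module.End B (selfInjectiveHull B A E) ≃+* ExtendedCentre ι E)
      (j : invariantSubring ι hι →+* ExtendedCentre ι E),
      -- (1)
      (∀ f, (Ψ f : selfInjectiveHull B A E) = f (toSelfInjectiveHull i 1)) ∧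
      (∀ (r : invariantSubring ι hι) (f : Module.End B (selfInjectiveHull B A E)),
        (Ψ (scalarEnd ι hι E r * f) : selfInjectiveHull B A E) =
          ι (r : A) • (Ψ f : selfInjectiveHull B A E)) ∧
      Function.Injective j ∧
      (∀ r, (j r : selfInjectiveHull B A E) = toSelfInjectiveHull i (r : A)) ∧
      Module.Injective (ExtendedCentre ι E) (ExtendedCentre ι E) ∧
      IsVonNeumannRegularRing (ExtendedCentre ι E) ∧
      -- (2)
      Set.BijOn
        (fun e : ExtendedCentre ι E =>
          (LinearMap.range (Ψ.symm e)).comap (toSelfInjectiveHull i))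
        {e | IsIdempotentElem e ∧ e ∈ Set.center (ExtendedCentre ι E)}
        {I : Submodule B A | IsEssentiallyClosed I} ∧
      -- (3)
      (IsField (ExtendedCentre ι E) ↔ IsBPrime (⊥ : Submodule B A)) ∧
      -- (4)
      (∀ n : ℕ, 1 ≤ n →
        ((∃ (F : Fin n → Type (max u v)) (_ : ∀ l, Field (F l)),
            Nonempty (ExtendedCentre ι E ≃+* ∀ l, F l)) ↔
          HasGoldieDimension B A n)) ∧
      -- (5)
      ((∀ I : Submodule B A, I ≠ ⊥ → ∃ r ∈ invariantSubring ι hι, r ∈ I ∧ r ≠ 0) →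
        IsMaximalRingOfQuotients j ∧ IsNonsingularModule (invariantSubring ι hι) A) := by
  have hH := toSelfInjectiveHull_isSelfInjectiveHull hi
  let _ : CommRing (Module.End B (selfInjectiveHull B A E)) := hH.endCommRing hι hA
  let Ψ₀ : Module.End B (selfInjectiveHull B A E) ≃ ExtendedCentre ι E :=
    Equiv.ofBijective _ (evalOne_bijective hι hA hH)
  -- The ring structure on the invariants is by definition that of the endomorphism ring, so every
  -- claim reduces to the latter.
  let _ : CommRing (ExtendedCentre ι E) := Ψ₀.symm.commRing
  let Ψ : Module.End B (selfInjectiveHull B A E) ≃+* ExtendedCentre ι E := Ψ₀.symm.ringEquiv.symm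
  have hΨ : ∀ f, (Ψ f : selfInjectiveHull B A E) = f (toSelfInjectiveHull i 1) := fun f => rfl
  have hbaer := hH.end_baer hι hA
  refine ⟨inferInstance, Ψ, (Ψ : _ →+* _).comp (scalarEndHom hι E), hΨ, fun r f => rfl,
    Ψ.injective.comp (scalarEndHom_injective hι hH), fun r => ?_, ?_,
    (hH.end_isVonNeumannRegularRing hι hA).of_ringEquiv Ψ, ?_, ?_, fun n _ => ⟨?_, ?_⟩,
    fun hlarge => ⟨?_, isNonsingularModule_of_large hι hA hlarge⟩⟩
  · refine (scalarEnd_toSelfInjectiveHull hι r i 1).trans ?_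
    rw [mul_one]
  · exact hbaer.injective.of_ringEquiv_self Ψ
  · refine (hH.bijOn_isEssentiallyClosed hι hA).comp (f := Ψ.symm) ?_
    refine ⟨fun e he => he.1.map Ψ.symm, Ψ.symm.injective.injOn, fun e he => ?_⟩
    refine ⟨Ψ e, ⟨he.map Ψ, ?_⟩, Ψ.symm_apply_apply e⟩
    simp
  · rw [← hH.isField_iff_isBPrime hι hA]
    exact Ψ.toMulEquiv.symm.isField_congr
  · rintro ⟨F, _, ⟨Θ⟩⟩
    exact hH.hasGoldieDimension_of_ringEquiv hι hA (Ψ.trans Θ)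
  · intro h
    obtain ⟨F, hF, ⟨Θ⟩⟩ := hH.exists_ringEquiv_pi_field hι hA h
    exact ⟨F, hF, ⟨Ψ.symm.trans Θ⟩⟩
  · exact ((scalarEndHom_isRingOfQuotients hι hA hH hlarge).isMaximalRingOfQuotients
      hbaer).comp_ringEquiv Ψ
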